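/- All lattices are finite and nonempty. A lattice is extremal if its length (the largest $r$ with a chain $y_0<\dots<y_r$) equals both its number of join-irreducible and its number of meet-irreducible elements ($\hat 0$ is not join-irreducible, $\hat 1$ is not meet-irreducible). An element $x$ is left modular if $(y\vee x)\wedge z=y\vee(x\wedge z)$ for all $y\le z$; a lattice is left modular if it has a maximal chain of left modular elements, and trim if it is extremal and left modular. Let $\mathcal L$ be a trim lattice and let $\hat 0=x_0\lessdot x_1\lessdot\cdots\lessdot x_n=\hat 1$ be any maximal chain of left modular elements. Label each cover relation by $\gamma(y\lessdot z)=\min\{i : y\vee(x_i\wedge z)=z\}\in[n]=\{1,\dots,n\}$, and put $\mathrm D^\gamma(y)=\{\gamma(w\lessdot y): w\lessdot y\}$ and $\mathrm U^\gamma(y)=\{\gamma(y\lessdot z): y\lessdot z\}$. Then: 1. $\{\mathrm D^\gamma(y): y\in\mathcal L\}=\{\mathrm U^\gamma(y): y\in\mathcal L\}$. Write $\gamma(\mathcal L)$ for this collection (the independence complex of $\mathcal L$). 2. $\gamma(\mathcal L)$ is a simplicial complex with vertex set $[n]$: it is closed under taking subsets, contains $\emptyset$ and every $\{i\}$ with $i\in[n]$,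 and all its members are subsets of $[n]$. 3. $\gamma(\mathcal L)$ is flag: if $A$ is a finite set with $\{i,k\}\in\gamma(\mathcal L)$ for all $i,k\in A$ (including $i=k$), then $A\in\gamma(\mathcal L)$. 4. Suppose $n\ge 1$. There are a unique join-irreducible $j_1$ with $\min\{i: j_1\le x_i\}=1$ and a unique meet-irreducible $m_1$ with $\max\{i\in[n]: x_{i-1}\le m_1\}=1$. Both intervals $\mathcal L^1=[j_1,\hat 1]$ and $\mathcal L_1=[\hat 0,m_1]$ are trim lattices, and the restriction of $\gamma$ to the cover relations of each of them is, up to an order-preserving renaming of the labels, the labelling obtained as above from a maximal chain of left modular elements of that interval. The independence complexes $\gamma(\mathcal L^1)$ and $\gamma(\mathcal L_1)$ formed with the restricted labels (equally from the downward or from the upward label sets) satisfy $$\gamma(\mathcal L^1)=\{G\in\gamma(\mathcal L): 1\notin G\},\qquad \gamma(\mathcal L_1)=\{G\in\gamma(\mathcal L): 1\notin G,\ G\cup\{1\}\in\gamma(\mathcal L)\},$$ that is, they are the deletion and the link of the vertex $1$ in $\gamma(\mathcal L)$. -/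

import Mathlib

namespace TrimLattice

/-- `x` is a left modular element: `(y ⊔ x) ⊓ z = y ⊔ (x ⊓ z)` whenever `y ≤ z`. -/
def IsLeftModularElement {α : Type*} [Lattice α] (x : α) : Prop :=
  ∀ y z : α, y ≤ z → (y ⊔ x) ⊓ z = y ⊔ (x ⊓ z)

/-- `⊥ = x 0 ⋖ x 1 ⋖ ⋯ ⋖ x n = ⊤` is a maximal chain of left modular elements.
(The values of `x` beyond `n` play no role.) -/
structure IsLeftModularChain {α : Type*} [Lattice α] [BoundedOrder α] (n : ℕ) (x : ℕ → α) :
    Prop where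
  bot : x 0 = ⊥
  top : x n = ⊤
  covBy : ∀ i < n, x i ⋖ x (i + 1)
  leftModular : ∀ i ≤ n, IsLeftModularElement (x i)

/-- A lattice is left modular if it has a maximal chain of left modular elements. -/
def IsLeftModularLattice (α : Type*) [Lattice α] [BoundedOrder α] : Prop :=
  ∃ (n : ℕ) (x : ℕ → α), IsLeftModularChain n x

/-- A (finite) lattice is extremal if its length `n` (the largest length of a chain
`x₀ < ⋯ < xₙ`) equals both its number of join-irreducible and its number of meet-irreducible
elements. The bottom is not join-irreducible and the top is not meet-irreducible. -/
def IsExtremal (α : Type*) [Lattice α] : Prop :=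
  ∃ n : ℕ, Order.krullDim α = n ∧ {j : α | SupIrred j}.ncard = n ∧ {m : α | InfIrred m}.ncard = n

/-- A (finite) lattice is trim if it is extremal and left modular. -/
structure IsTrim (α : Type*) [Lattice α] [BoundedOrder α] : Prop where
  extremal : IsExtremal α
  leftModular : IsLeftModularLattice α

/-- The label of a join-irreducible `j`: the least `i` with `j ≤ x i`. -/
noncomputable def joinLabel {α : Type*} [Lattice α] (x : ℕ → α) (j : α) : ℕ :=
  sInf {i : ℕ | j ≤ x i}

/-- The label of a meet-irreducible `m`: the largest `i` in `{1, …, n}` with `x (i - 1) ≤ m`. -/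
noncomputable def meetLabel {α : Type*} [Lattice α] (n : ℕ) (x : ℕ → α) (m : α) : ℕ :=
  sSup {i : ℕ | 1 ≤ i ∧ i ≤ n ∧ x (i - 1) ≤ m}

/-- The left modular labelling of cover relations given by the chain `x`: the label of `y ⋖ z`
is the least `i` with `y ⊔ (x i ⊓ z) = z`. (Only values at cover relations are ever used.) -/
noncomputable def coverLabel {α : Type*} [Lattice α] (x : ℕ → α) (y z : α) : ℕ :=
  sInf {i : ℕ | y ⊔ (x i ⊓ z) = z}

/-- The set of downward labels of `y`: the labels of the covers `w ⋖ y`. -/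
def downLabels {α : Type*} [Lattice α] (γ : α → α → ℕ) (y : α) : Set ℕ :=
  {i | ∃ w, w ⋖ y ∧ γ w y = i}

/-- The set of upward labels of `y`: the labels of the covers `y ⋖ z`. -/
def upLabels {α : Type*} [Lattice α] (γ : α → α → ℕ) (y : α) : Set ℕ :=
  {i | ∃ z, y ⋖ z ∧ γ y z = i}

/-- The collection of all downward label sets of a labelled lattice. For a trim lattice with a left
modular labelling this is the independence complex. -/
def independenceComplex {α : Type*} [Lattice α] (γ : α → α → ℕ) : Set (Set ℕ) :=
  Set.range (downLabels γ)

/-- The collection of all upward label sets of a labelled lattice. -/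
def upLabelSets {α : Type*} [Lattice α] (γ : α → α → ℕ) : Set (Set ℕ) :=
  Set.range (upLabels γ)

/-- The restriction of a labelling to a subset of the lattice. -/
def restrictLabelling {α : Type*} (γ : α → α → ℕ) (S : Set α) : S → S → ℕ :=
  fun y z => γ y z

/-- The labelling `γ` is, up to an order-preserving renaming `e` of the labels, the left modular
labelling given by some left modular chain. -/
def IsLeftModularLabelling {α : Type*} [Lattice α] [BoundedOrder α] (γ : α → α → ℕ) : Prop :=
  ∃ (n : ℕ) (x : ℕ → α) (e : ℕ → ℕ), IsLeftModularChain n x ∧ StrictMonoOn e (Set.Icc 1 n) ∧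
    ∀ y z : α, y ⋖ z → γ y z = e (coverLabel x y z)

/-- `Δ` is a simplicial complex with (finite) vertex set `V`; the empty set counts as a face. -/
structure IsSimplicialComplex {ι : Type*} (V : Set ι) (Δ : Set (Set ι)) : Prop where
  subset_vertices : ∀ F ∈ Δ, F ⊆ V
  empty_mem : ∅ ∈ Δ
  singleton_mem : ∀ v ∈ V, {v} ∈ Δ
  down_closed : ∀ F ∈ Δ, ∀ G, G ⊆ F → G ∈ Δ

/-- `Δ` is flag: every finite clique of its 1-skeleton is a face. (The case `i = k` says that the
members of `A` are vertices of `Δ`.) -/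
def IsFlag {ι : Type*} (Δ : Set (Set ι)) : Prop :=
  ∀ A : Set ι, A.Finite → (∀ i ∈ A, ∀ k ∈ A, {i, k} ∈ Δ) → A ∈ Δ

/-- The deletion of `F` in `Δ`. -/
def deletion {ι : Type*} (Δ : Set (Set ι)) (F : Set ι) : Set (Set ι) :=
  {G | G ∈ Δ ∧ G ∩ F = ∅}

/-- The link of `F` in `Δ`. -/
def link {ι : Type*} (Δ : Set (Set ι)) (F : Set ι) : Set (Set ι) :=
  {G | G ∈ Δ ∧ G ∩ F = ∅ ∧ G ∪ F ∈ Δ}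

end TrimLattice

namespace TrimLattice

/-! Extremality attaches to each step from `x (i - 1)` to `x i` exactly one join-irreducible `j i`
and one meet-irreducible `m i`, and a cover `y ⋖ z` has label `i` iff `j i ≤ z` and `y ≤ m i`. Call
distinct labels `i`, `k` compatible if `j i ≤ m k` and `j k ≤ m i`; the relation from smaller to
larger label is automatic. The core is that distinct labels of covers below one element are
compatible (`join_le_of_covBy`). Conversely, pairwise compatible labels are exactly the down-labels
of the join of their `j i`. So the down-label sets are the independent sets of a graph, which gives
a flag complex. Order reversal preserves compatibility, so the up-label sets are the same.

`LabelData` keeps only what this argument needs. By allowing repetitions in the chain it is stable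
under duality and under passing to `[⊥, u]` and `[v, ⊤]`, where the surviving labels are those with
`j i ≤ u`, respectively `v ≤ m i`. It also implies trimness once repetitions are removed. For `u = m
1` and `v = j 1` the surviving faces are the link and the deletion, because `1` is the smallest
label. -/

/-! ### Left modular elements: duality, intervals, covers -/

theorem IsLeftModularElement.toDual {α : Type*} [Lattice α] {x : α}
    (hx : IsLeftModularElement x) : IsLeftModularElement (OrderDual.toDual x) := by
  intro y z hyz
  have h := hx (OrderDual.ofDual z) (OrderDual.ofDual y) hyz
  apply OrderDual.ofDual.injective
  change (OrderDual.ofDual y ⊓ x) ⊔ OrderDual.ofDual z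
    = OrderDual.ofDual y ⊓ (x ⊔ OrderDual.ofDual z)
  rw [inf_comm, sup_comm, inf_comm (OrderDual.ofDual y), sup_comm x, h]

theorem IsLeftModularElement.inf_Iic {α : Type*} [Lattice α] {x : α}
    (hx : IsLeftModularElement x) (u : α) :
    IsLeftModularElement (⟨x ⊓ u, inf_le_right⟩ : Set.Iic u) := by
  rintro ⟨y, hy⟩ ⟨z, hz⟩ hyz
  apply Subtype.ext
  change (y ⊔ x ⊓ u) ⊓ z = y ⊔ (x ⊓ u ⊓ z)
  have hz' : z ≤ u := hz
  rw [← hx y u hy, inf_assoc, inf_assoc, inf_eq_right.2 hz', hx y z hyz]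

theorem IsLeftModularElement.sup_Ici {α : Type*} [Lattice α] {x : α}
    (hx : IsLeftModularElement x) (v : α) :
    IsLeftModularElement (⟨x ⊔ v, le_sup_right⟩ : Set.Ici v) := by
  rintro ⟨y, hy⟩ ⟨z, hz⟩ hyz
  apply Subtype.ext
  change (y ⊔ (x ⊔ v)) ⊓ z = y ⊔ ((x ⊔ v) ⊓ z)
  have hy' : v ≤ y := hy
  rw [sup_comm x v, hx v z hz, ← sup_assoc, ← sup_assoc, sup_eq_left.2 hy', hx y z hyz]

/-- For `t` strictly between, `t ⊔ a` is `a` or `b`, and left modularity of `a` recovers `t` as `(t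
⊔ a) ⊓ z`. -/
theorem IsLeftModularElement.inf_wcovBy {α : Type*} [Lattice α] {a b : α}
    (ha : IsLeftModularElement a) (hab : a ⩿ b) (z : α) : a ⊓ z ⩿ b ⊓ z := by
  refine ⟨inf_le_inf_right z hab.le, fun t h1 h2 => ?_⟩
  have htz : t ≤ z := h2.le.trans inf_le_right
  have htb : t ≤ b := h2.le.trans inf_le_left
  rcases hab.eq_or_eq (c := t ⊔ a) le_sup_right (sup_le htb hab.le) with h | h
  · exact h1.not_ge (le_inf (le_sup_left.trans h.le) htz)
  · have := ha t z htz
    rw [h, sup_eq_left.2 h1.le] at this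
    exact h2.ne this.symm

/-- This makes the chain projected to `[y, z]` have no gaps. Here left modularity of `b` recovers an
intermediate `t` as `y ⊔ b ⊓ t`. -/
theorem IsLeftModularElement.sup_inf_wcovBy {α : Type*} [Lattice α] {a b y z : α}
    (ha : IsLeftModularElement a) (hb : IsLeftModularElement b) (hab : a ⩿ b) (hyz : y ≤ z) :
    y ⊔ a ⊓ z ⩿ y ⊔ b ⊓ z := by
  have hw := ha.inf_wcovBy hab z
  refine ⟨sup_le_sup_left hw.le y, fun t h1 h2 => ?_⟩
  have htz : t ≤ z := h2.le.trans (sup_le hyz inf_le_right)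
  rcases hw.eq_or_eq (c := t ⊓ (b ⊓ z)) (le_inf (le_sup_right.trans h1.le) hw.le) inf_le_right
    with h | h
  · have hbt : b ⊓ t = a ⊓ z := by
      rw [← h, inf_left_comm, inf_eq_left.2 htz]
    have := hb y t (le_sup_left.trans h1.le)
    rw [hbt, inf_eq_right.2 (h2.le.trans (sup_le_sup_left inf_le_left y))] at this
    exact h1.ne this.symm
  · exact h2.not_ge (sup_le (le_sup_left.trans h1.le) (inf_eq_right.1 h))

theorem IsLeftModularElement.sup_wcovBy {α : Type*} [Lattice α] {a b : α}
    (hb : IsLeftModularElement b) (hab : a ⩿ b) (y : α) : a ⊔ y ⩿ b ⊔ y := by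
  simpa using (hb.toDual.inf_wcovBy hab.toDual (OrderDual.toDual y)).ofDual

/-! ### Label data and the label of a cover -/

/-- A weakly increasing left modular chain `x 0, …, x n` together with elements `j i` and `m i`,
indexed by the places `i ∈ S` where it increases, that detect the labels of cover relations. -/
structure LabelData {α : Type*} [Lattice α] [BoundedOrder α] (n : ℕ) (x : ℕ → α) (S : Set ℕ)
    (j m : ℕ → α) : Prop where
  bot : x 0 = ⊥
  top : x n = ⊤
  wcovBy : ∀ i < n, x i ⩿ x (i + 1)
  leftModular : ∀ i ≤ n, IsLeftModularElement (x i)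
  subset : S ⊆ Set.Icc 1 n
  join_le : ∀ i ∈ S, j i ≤ x i
  le_meet : ∀ i ∈ S, x (i - 1) ≤ m i
  not_le : ∀ i ∈ S, ¬ j i ≤ m i
  label : ∀ i ∈ Set.Icc 1 n, ∀ y z, y ⋖ z → z ≤ y ⊔ x i → x (i - 1) ⊓ z ≤ y →
    i ∈ S ∧ j i ≤ z ∧ y ≤ m i

/-- The independent sets of the graph on `S` in which `i ≠ k` are adjacent when `j i ≰ m k`
or `j k ≰ m i`. -/
def IsIndependent {α : Type*} [Lattice α] (S : Set ℕ) (j m : ℕ → α) (A : Set ℕ) : Prop :=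
  A ⊆ S ∧ ∀ i ∈ A, ∀ k ∈ A, i ≠ k → j i ≤ m k

namespace LabelData

variable {α : Type*} [Lattice α] [BoundedOrder α] {n : ℕ} {x : ℕ → α} {S : Set ℕ} {j m : ℕ → α}

/-- The step into place `i`, read backwards, is the step into place `n + 1 - i`; `j` and `m` change
roles. Upward statements thus reduce to downward ones. -/
theorem dual (h : LabelData n x S j m) :
    LabelData n (fun i => OrderDual.toDual (x (n - i))) {i | i ∈ Set.Icc 1 n ∧ n + 1 - i ∈ S}
      (fun i => OrderDual.toDual (m (n + 1 - i))) (fun i => OrderDual.toDual (j (n + 1 - i))) where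
  bot := by simp [h.top]
  top := by simp [h.bot]
  wcovBy i hi := by
    have := h.wcovBy (n - (i + 1)) (by omega)
    rw [show n - (i + 1) + 1 = n - i by omega] at this
    exact this.toDual
  leftModular i _ := (h.leftModular (n - i) (by omega)).toDual
  subset i hi := hi.1
  join_le i hi := by
    have := h.le_meet _ hi.2
    rwa [show n + 1 - i - 1 = n - i by omega] at this
  le_meet i hi := by
    have := h.join_le _ hi.2
    have hi1 := hi.1.1
    simpa only [show n - (i - 1) = n + 1 - i by omega, OrderDual.toDual_le_toDual]
  not_le i hi := h.not_le _ hi.2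
  label i hi y z hyz h1 h2 := by
    have hi1 := hi.1
    have hi2 := hi.2
    have h1' : OrderDual.ofDual y ⊓ x (n - i) ≤ OrderDual.ofDual z := h1
    have h2' : OrderDual.ofDual y ≤ x (n - (i - 1)) ⊔ OrderDual.ofDual z := h2
    rw [show n - (i - 1) = n + 1 - i by omega, sup_comm] at h2'
    rw [show n - i = n + 1 - i - 1 by omega, inf_comm] at h1'
    obtain ⟨a, b, c⟩ := h.label (n + 1 - i) ⟨by omega, by omega⟩ _ _ hyz.ofDual h2' h1'
    exact ⟨⟨hi, a⟩, c, b⟩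

theorem monotone (h : LabelData n x S j m) {i k : ℕ} (hik : i ≤ k) (hk : k ≤ n) : x i ≤ x k := by
  induction k, hik using Nat.le_induction with
  | base => exact le_rfl
  | succ k _ ih => exact (ih (by omega)).trans (h.wcovBy k (by omega)).le

theorem join_le_meet (h : LabelData n x S j m) {i k : ℕ} (hi : i ∈ S) (hk : k ∈ S) (hik : i < k) :
    j i ≤ m k := by
  have := (h.subset hk).2
  exact (h.join_le i hi).trans ((h.monotone (by omega) (by omega)).trans (h.le_meet k hk))

theorem coverLabel_spec (h : LabelData n x S j m) {y z : α} (hyz : y ⋖ z) :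
    coverLabel x y z ∈ S ∧ j (coverLabel x y z) ≤ z ∧ y ≤ m (coverLabel x y z) ∧
      y ⊔ x (coverLabel x y z) ⊓ z = z ∧ x (coverLabel x y z - 1) ⊓ z ≤ y := by
  have hn : n ∈ {i : ℕ | y ⊔ (x i ⊓ z) = z} := by simp [h.top, hyz.le]
  have hmem := Nat.sInf_mem ⟨n, hn⟩
  have hle : coverLabel x y z ≤ n := Nat.sInf_le hn
  change y ⊔ x (coverLabel x y z) ⊓ z = z at hmem
  have h0 : 1 ≤ coverLabel x y z := by
    by_contra! hc
    rw [show coverLabel x y z = 0 by omega, h.bot] at hmem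
    exact hyz.ne (by simpa using hmem)
  have hlt : ¬ y ⊔ x (coverLabel x y z - 1) ⊓ z = z := fun hc => by
    have : coverLabel x y z ≤ coverLabel x y z - 1 := Nat.sInf_le hc
    omega
  -- Minimality of the label: one place earlier the join with `y` is not yet `z`, so it is still
  -- `y`.
  have hy : x (coverLabel x y z - 1) ⊓ z ≤ y := by
    rcases hyz.eq_or_eq (c := y ⊔ x (coverLabel x y z - 1) ⊓ z) le_sup_left
      (sup_le hyz.le inf_le_right) with e | e
    · exact sup_eq_left.1 e
    · exact absurd e hlt
  obtain ⟨a, b, c⟩ := h.label _ ⟨h0, hle⟩ y z hyz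
    (hmem.symm.le.trans (sup_le_sup_left inf_le_left y)) hy
  exact ⟨a, b, c, hmem, hy⟩

/-- Let `k` be the label. For `i > k`, `z = y ⊔ x k ⊓ z ≤ m i`; for `i < k`, `j i ≤ x (k - 1) ⊓ z ≤
y ≤ m i`. Either way `j i ≤ m i`, which is excluded. -/
theorem coverLabel_eq_iff (h : LabelData n x S j m) {y z : α} (hyz : y ⋖ z) {i : ℕ} :
    coverLabel x y z = i ↔ i ∈ S ∧ j i ≤ z ∧ y ≤ m i := by
  obtain ⟨a, b, c, d, e⟩ := h.coverLabel_spec hyz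
  constructor
  · rintro rfl
    exact ⟨a, b, c⟩
  · rintro ⟨hi, hj, hm⟩
    have hi2 := (h.subset hi).2
    have hk2 := (h.subset a).2
    rcases lt_trichotomy (coverLabel x y z) i with hlt | heq | hlt
    · refine absurd (hj.trans (d.symm.le.trans (sup_le hm (inf_le_left.trans ?_)))) (h.not_le i hi)
      exact (h.monotone (by omega) (by omega)).trans (h.le_meet i hi)
    · exact heq
    · refine absurd ((le_inf ((h.join_le i hi).trans ?_) hj).trans (e.trans hm)) (h.not_le i hi)
      exact h.monotone (by omega) (by omega)

theorem coverLabel_eq_of_le (h : LabelData n x S j m) {y z : α} (hyz : y ⋖ z) {i : ℕ}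
    (hi : i ∈ Set.Icc 1 n) (h1 : z ≤ y ⊔ x i) (h2 : x (i - 1) ⊓ z ≤ y) :
    coverLabel x y z = i :=
  (h.coverLabel_eq_iff hyz).2 (h.label i hi y z hyz h1 h2)

theorem mem_downLabels (h : LabelData n x S j m) {y : α} {i : ℕ} :
    i ∈ downLabels (coverLabel x) y ↔ i ∈ S ∧ j i ≤ y ∧ ∃ w, w ⋖ y ∧ w ≤ m i := by
  constructor
  · rintro ⟨w, hw, rfl⟩
    obtain ⟨a, b, c, _⟩ := h.coverLabel_spec hw
    exact ⟨a, b, w, hw, c⟩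
  · rintro ⟨a, b, w, hw, c⟩
    exact ⟨w, hw, (h.coverLabel_eq_iff hw).2 ⟨a, b, c⟩⟩

theorem mem_upLabels (h : LabelData n x S j m) {y : α} {i : ℕ} :
    i ∈ upLabels (coverLabel x) y ↔ i ∈ S ∧ y ≤ m i ∧ ∃ z, y ⋖ z ∧ j i ≤ z := by
  constructor
  · rintro ⟨w, hw, rfl⟩
    obtain ⟨a, b, c, _⟩ := h.coverLabel_spec hw
    exact ⟨a, c, w, hw, b⟩
  · rintro ⟨a, b, w, hw, c⟩
    exact ⟨w, hw, (h.coverLabel_eq_iff hw).2 ⟨a, c, b⟩⟩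

/-! ### Label sets are the independent sets -/

/-- The left modular chain of an interval `[y, z]` provides a lower cover of `z` with prescribed
label. -/
theorem exists_covBy_coverLabel_eq (h : LabelData n x S j m) {y z : α} {i : ℕ} (hi : i ∈ Set.Icc 1 n)
    (hyz : y ≤ z) (h1 : z ≤ y ⊔ x i) (h2 : ¬ z ≤ y ⊔ x (i - 1)) :
    ∃ c, c ⋖ z ∧ coverLabel x c z = i := by
  have hi1 := hi.1
  have hi2 := hi.2
  have hw := (h.leftModular (i - 1) (by omega)).sup_inf_wcovBy (h.leftModular i hi2)
    (by simpa [Nat.sub_add_cancel hi1] using h.wcovBy (i - 1) (by omega)) hyz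
  rw [← h.leftModular i hi2 y z hyz, inf_eq_right.2 h1] at hw
  have hc := hw.covBy_of_ne fun e => h2 <| by
    rw [← e]
    exact sup_le_sup_left inf_le_left y
  exact ⟨_, hc, h.coverLabel_eq_of_le hc hi
    (h1.trans (sup_le_sup_right le_sup_left _)) le_sup_right⟩

/-- If `j k ≰ a`, with `k` the label below `b`, then a cover `a' ⋖ a` above `a ⊓ b` has a label `p >
k` with `j p ≰ b`, and `z` has a lower cover `c` with the same label `p`. The pair `b`, `c` then
violates the statement with a larger smaller label, so induction ends the argument. -/
theorem join_le_of_covBy [Finite α] (h : LabelData n x S j m) {a b z : α} (ha : a ⋖ z) (hb : b ⋖ z)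
    (hab : coverLabel x a z < coverLabel x b z) : j (coverLabel x b z) ≤ a := by
  induction hd : n - coverLabel x a z using Nat.strong_induction_on generalizing a b with
  | _ d ih =>
  subst hd
  obtain ⟨hbS, hbj, hbm, hb1, hb2⟩ := h.coverLabel_spec hb
  obtain ⟨haS, haj, ham, ha1, ha2⟩ := h.coverLabel_spec ha
  by_contra hk
  have hlt : a ⊓ b < a := inf_lt_left.2 fun hle => by
    rcases ha.eq_or_eq hle hb.le with e | e
    · subst e
      exact lt_irrefl _ hab
    · exact hb.ne e
  obtain ⟨a', hle, ha'⟩ := exists_le_covBy_of_lt hlt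
  obtain ⟨hpS, hpj, hpm, hp1, hp2⟩ := h.coverLabel_spec ha'
  set p := coverLabel x a' a with hp
  set k := coverLabel x b z with hkdef
  set i := coverLabel x a z with hidef
  have hpn := h.subset hpS
  have hkn := h.subset hbS
  -- Otherwise `j p ≤ a ⊓ b ≤ a' ≤ m p`.
  have hpb : ¬ j p ≤ b := fun hc => h.not_le p hpS (((le_inf hpj hc).trans hle).trans hpm)
  have hkp : k < p := by
    rcases lt_trichotomy k p with hlt | heq | hlt
    · exact hlt
    · exact absurd (heq ▸ hpj) hk
    · refine absurd ((le_inf ((h.join_le p hpS).trans ?_) (hpj.trans ha.le)).trans hb2) hpb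
      exact h.monotone (by omega) (by have := hkn.2; omega)
  have hap : a ≤ a' ⊔ x p := hp1.symm.le.trans (sup_le_sup_left inf_le_left _)
  -- In `[a', z]` the chain reaches `z` exactly at place `p`: `x p` suffices because `i < p`, while
  -- `a' ⊔ x (p - 1) ≤ m p` and `j p ≤ z`.
  obtain ⟨c, hc, hcl⟩ := h.exists_covBy_coverLabel_eq hpn (ha'.le.trans ha.le)
    (ha1.symm.le.trans (sup_le hap ((inf_le_left.trans (h.monotone (by omega) hpn.2)).trans
      le_sup_right)))
    (fun hc => h.not_le p hpS ((hpj.trans (ha.le.trans hc)).trans (sup_le hpm (h.le_meet p hpS))))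
  have := ih (n - k) (by have := hkn.2; omega) hb hc (by rw [hcl]; exact hkp) rfl
  rw [hcl] at this
  exact hpb this

theorem isIndependent_downLabels [Finite α] (h : LabelData n x S j m) (y : α) :
    IsIndependent S j m (downLabels (coverLabel x) y) := by
  refine ⟨fun i hi => (h.mem_downLabels.1 hi).1, ?_⟩
  rintro _ ⟨a, ha, rfl⟩ _ ⟨b, hb, rfl⟩ hne
  rcases hne.lt_or_gt with hlt | hlt
  · exact h.join_le_meet (h.coverLabel_spec ha).1 (h.coverLabel_spec hb).1 hlt
  · exact (h.join_le_of_covBy hb ha hlt).trans (h.coverLabel_spec hb).2.2.1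

theorem exists_downLabels_eq [Finite α] (h : LabelData n x S j m) {A : Set ℕ}
    (hA : IsIndependent S j m A) : ∃ y, downLabels (coverLabel x) y = A := by
  classical
  have hfin : A.Finite := (Set.finite_Icc 1 n).subset (hA.1.trans h.subset)
  obtain ⟨A, rfl⟩ := hfin.exists_finset_coe
  have hsub : ↑A ⊆ downLabels (coverLabel x) (A.sup j) := by
    intro k hk
    have hkS := hA.1 hk
    have hvm : (A.erase k).sup j ≤ m k := Finset.sup_le fun i hi =>
      hA.2 i (Finset.mem_of_mem_erase hi) k hk (Finset.ne_of_mem_erase hi)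
    have hy : A.sup j = (A.erase k).sup j ⊔ j k := by
      rw [sup_comm, ← Finset.sup_insert, Finset.insert_erase hk]
    obtain ⟨c, hc, hcl⟩ := h.exists_covBy_coverLabel_eq (h.subset hkS)
      (show (A.erase k).sup j ≤ A.sup j from hy ▸ le_sup_left)
      (hy.le.trans (sup_le_sup_left (h.join_le k hkS) _))
      (fun hc => h.not_le k hkS (((Finset.le_sup hk).trans hc).trans
        (sup_le hvm (h.le_meet k hkS))))
    exact ⟨c, hc, hcl⟩
  refine ⟨A.sup j, Set.Subset.antisymm (fun i hi => ?_) hsub⟩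
  -- A further label would be compatible with all of `A`, so the whole join would lie below its `m
  -- i`, although `j i` lies below the join.
  by_contra hiA
  have hind := h.isIndependent_downLabels (A.sup j)
  have : A.sup j ≤ m i := Finset.sup_le fun a ha =>
    hind.2 a (hsub ha) i hi fun e => hiA (e ▸ ha)
  exact h.not_le i (hind.1 hi) ((h.mem_downLabels.1 hi).2.1.trans this)

theorem mem_independenceComplex [Finite α] (h : LabelData n x S j m) {A : Set ℕ} :
    A ∈ independenceComplex (coverLabel x) ↔ IsIndependent S j m A :=
  ⟨by rintro ⟨y, rfl⟩; exact h.isIndependent_downLabels y, h.exists_downLabels_eq⟩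

theorem mem_upLabelSets [Finite α] (h : LabelData n x S j m) {A : Set ℕ} :
    A ∈ upLabelSets (coverLabel x) ↔ IsIndependent S j m A := by
  have hr : ∀ i ∈ Set.Icc 1 n, n + 1 - i ∈ Set.Icc 1 n ∧ n + 1 - (n + 1 - i) = i := by
    rintro i ⟨h1, h2⟩
    exact ⟨⟨by omega, by omega⟩, by omega⟩
  -- Up-labels are the down-labels of the dual data after `i ↦ n + 1 - i`.
  have hd : ∀ (y : α) (i : ℕ), i ∈ Set.Icc 1 n →
      (n + 1 - i ∈ downLabels (coverLabel fun i => OrderDual.toDual (x (n - i)))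
        (OrderDual.toDual y) ↔ i ∈ upLabels (coverLabel x) y) := by
    intro y i hi
    rw [h.dual.mem_downLabels, h.mem_upLabels]
    simp only [Set.mem_ofPred_eq, (hr i hi).1, (hr i hi).2, true_and]
    refine and_congr_right fun _ => and_congr Iff.rfl ?_
    exact ⟨fun ⟨w, h1, h2⟩ => ⟨OrderDual.ofDual w, h1.ofDual, h2⟩,
      fun ⟨w, h1, h2⟩ => ⟨OrderDual.toDual w, h1.toDual, h2⟩⟩
  constructor
  · rintro ⟨y, rfl⟩
    have hS : upLabels (coverLabel x) y ⊆ S := fun i hi => (h.mem_upLabels.1 hi).1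
    refine ⟨hS, fun i hi k hk hik => ?_⟩
    have hin := h.subset (hS hi)
    have hkn := h.subset (hS hk)
    have := (h.dual.isIndependent_downLabels (OrderDual.toDual y)).2 _ ((hd y k hkn).2 hk)
      _ ((hd y i hin).2 hi) (by have := hin.2; have := hkn.2; omega)
    simpa only [(hr i hin).2, (hr k hkn).2, OrderDual.toDual_le_toDual] using this
  · intro hA
    obtain ⟨y, hy⟩ := h.dual.exists_downLabels_eq (A := {i | i ∈ Set.Icc 1 n ∧ n + 1 - i ∈ A})
      ⟨fun i hi => ⟨hi.1, hA.1 hi.2⟩, fun i hi k hk hik =>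
        hA.2 _ hk.2 _ hi.2 (by have := hi.1.2; have := hk.1.2; omega)⟩
    refine ⟨OrderDual.ofDual y, Set.ext fun i => ?_⟩
    constructor
    · intro hi
      have hin := h.subset (h.mem_upLabels.1 hi).1
      have := (hd _ i hin).2 hi
      rw [OrderDual.toDual_ofDual, hy, Set.mem_ofPred_eq, (hr i hin).2] at this
      exact this.2
    · intro hi
      have hin := h.subset (hA.1 hi)
      refine (hd _ i hin).1 ?_
      rw [OrderDual.toDual_ofDual, hy, Set.mem_ofPred_eq, (hr i hin).2]
      exact ⟨(hr i hin).1, hi⟩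

/-! ### Passage to intervals -/

/-- A cover labelled `i` inside `[⊥, u]` has `j i` below its top, hence below `u`; so only such
places survive and the cut chain repeats at the others. On surviving places `j i ⊓ u` is just `j i`.
-/
theorem Iic (h : LabelData n x S j m) (u : α) :
    LabelData n (fun i => (⟨x i ⊓ u, inf_le_right⟩ : Set.Iic u)) {i | i ∈ S ∧ j i ≤ u}
      (fun i => ⟨j i ⊓ u, inf_le_right⟩) (fun i => ⟨m i ⊓ u, inf_le_right⟩) where
  bot := Subtype.ext (by simp [h.bot])
  top := Subtype.ext (by simp [h.top])
  wcovBy i hi := by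
    have := (h.leftModular i hi.le).inf_wcovBy (h.wcovBy i hi) u
    exact ⟨this.le, fun c h1 h2 => this.2 (c := c) h1 h2⟩
  leftModular i hi := (h.leftModular i hi).inf_Iic u
  subset i hi := h.subset hi.1
  join_le i hi := inf_le_inf_right u (h.join_le i hi.1)
  le_meet i hi := inf_le_inf_right u (h.le_meet i hi.1)
  not_le i hi hc := h.not_le i hi.1
    ((le_inf le_rfl hi.2).trans (le_trans (show j i ⊓ u ≤ m i ⊓ u from hc) inf_le_left))
  label i hi y z hyz h1 h2 := by
    have hyz' : (y : α) ⋖ z := by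
      refine ⟨hyz.1, fun c hc1 hc2 => hyz.2 (c := ⟨c, hc2.le.trans z.2⟩) hc1 hc2⟩
    have h1' : (z : α) ≤ (y : α) ⊔ x i ⊓ u := h1
    have h2' : x (i - 1) ⊓ u ⊓ (z : α) ≤ y := h2
    have hz : (z : α) ≤ u := z.2
    rw [inf_assoc, inf_eq_right.2 hz] at h2'
    obtain ⟨a, b, c⟩ := h.label i hi y z hyz' (h1'.trans (sup_le_sup_left inf_le_left _)) h2'
    exact ⟨⟨a, b.trans hz⟩, show j i ⊓ u ≤ z from inf_le_left.trans b,
      show (y : α) ≤ m i ⊓ u from le_inf c y.2⟩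

theorem Ici (h : LabelData n x S j m) (v : α) :
    LabelData n (fun i => (⟨x i ⊔ v, le_sup_right⟩ : Set.Ici v)) {i | i ∈ S ∧ v ≤ m i}
      (fun i => ⟨j i ⊔ v, le_sup_right⟩) (fun i => ⟨m i ⊔ v, le_sup_right⟩) where
  bot := Subtype.ext (by simp [h.bot])
  top := Subtype.ext (by simp [h.top])
  wcovBy i hi := by
    have := (h.leftModular (i + 1) hi).sup_wcovBy (h.wcovBy i hi) v
    exact ⟨this.le, fun c h1 h2 => this.2 (c := c) h1 h2⟩
  leftModular i hi := (h.leftModular i hi).sup_Ici v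
  subset i hi := h.subset hi.1
  join_le i hi := sup_le_sup_right (h.join_le i hi.1) v
  le_meet i hi := sup_le_sup_right (h.le_meet i hi.1) v
  not_le i hi hc := h.not_le i hi.1
    (le_trans (le_trans le_sup_left (show j i ⊔ v ≤ m i ⊔ v from hc)) (sup_le le_rfl hi.2))
  label i hi y z hyz h1 h2 := by
    have hyz' : (y : α) ⋖ z := by
      refine ⟨hyz.1, fun c hc1 hc2 => hyz.2 (c := ⟨c, le_trans y.2 hc1.le⟩) hc1 hc2⟩
    have h1' : (z : α) ≤ (y : α) ⊔ (x i ⊔ v) := h1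
    have h2' : (x (i - 1) ⊔ v) ⊓ (z : α) ≤ y := h2
    have hy : v ≤ (y : α) := y.2
    rw [sup_comm (x i), ← sup_assoc, sup_eq_left.2 hy] at h1'
    obtain ⟨a, b, c⟩ := h.label i hi y z hyz' h1' ((inf_le_inf_right _ le_sup_left).trans h2')
    exact ⟨⟨a, hy.trans c⟩, show j i ⊔ v ≤ z from sup_le b z.2,
      show (y : α) ≤ m i ⊔ v from c.trans le_sup_left⟩

end LabelData

/-! ### Irreducibles and length -/

theorem exists_supIrred_le_not_le {α : Type*} [Lattice α] [BoundedOrder α] [Finite α] {a b : α}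
    (hab : ¬ a ≤ b) : ∃ p, SupIrred p ∧ p ≤ a ∧ ¬ p ≤ b := by
  obtain ⟨s, hs, hp⟩ := exists_supIrred_decomposition a
  by_contra! hc
  refine hab (hs ▸ Finset.sup_le fun p hps => hc p (hp hps) ?_)
  rw [← hs]
  exact Finset.le_sup (f := id) hps

theorem exists_infIrred_le_not_le {α : Type*} [Lattice α] [BoundedOrder α] [Finite α] {a b : α}
    (hab : ¬ a ≤ b) : ∃ p, InfIrred p ∧ b ≤ p ∧ ¬ a ≤ p := by
  obtain ⟨p, h1, h2, h3⟩ := exists_supIrred_le_not_le (α := αᵒᵈ) (a := OrderDual.toDual b)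
    (b := OrderDual.toDual a) hab
  exact ⟨OrderDual.ofDual p, h1.ofDual, h2, h3⟩

theorem krullDim_le_ncard_of_strictMono {α : Type*} [Preorder α] {S : Set ℕ} (hS : S.Finite)
    (f : α → Set ℕ) (hf : StrictMono f) (hfS : ∀ y, f y ⊆ S) : Order.krullDim α ≤ S.ncard := by
  let g : α → Fin (S.ncard + 1) := fun y =>
    ⟨(f y).ncard, Nat.lt_succ_of_le (Set.ncard_le_ncard (hfS y) hS)⟩
  have hg : StrictMono g := fun y z hyz => Set.ncard_lt_ncard (hf hyz) (hS.subset (hfS z))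
  refine iSup_le fun p => ?_
  have := (p.map g hg).length_lt_card
  rw [Fintype.card_fin, Nat.lt_succ_iff] at this
  exact_mod_cast this

theorem IsLeftModularChain.le_krullDim {α : Type*} [Lattice α] [BoundedOrder α] {n : ℕ}
    {x : ℕ → α} (hx : IsLeftModularChain n x) : (n : WithBot ℕ∞) ≤ Order.krullDim α :=
  Order.LTSeries.length_le_krullDim (LTSeries.mk n (fun i => x i)
    (Fin.strictMono_iff_lt_succ.2 fun i => (hx.covBy i i.2).lt))

theorem strictMono_of_covBy {α β : Type*} [PartialOrder α] [Finite α] [Preorder β] {f : α → β}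
    (hf : Monotone f) (h : ∀ y z, y ⋖ z → ¬ f z ≤ f y) : StrictMono f := by
  intro y z hyz
  obtain ⟨w, hw, hwz⟩ := exists_covBy_le_of_lt hyz
  exact lt_of_le_not_ge (hf hyz.le) fun hc => h y w hw ((hf hwz).trans hc)

namespace LabelData

variable {α : Type*} [Lattice α] [BoundedOrder α] {n : ℕ} {x : ℕ → α} {S : Set ℕ} {j m : ℕ → α}

/-- Going up a cover with label `i` acquires `j i`, since `y ≤ m i` rules out `j i ≤ y`. -/
theorem krullDim_le [Finite α] (h : LabelData n x S j m) : Order.krullDim α ≤ S.ncard := by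
  refine krullDim_le_ncard_of_strictMono ((Set.finite_Icc 1 n).subset h.subset) (fun y => {i | i ∈ S ∧ j i ≤ y})
    (strictMono_of_covBy (fun y z hyz i hi => ⟨hi.1, hi.2.trans hyz⟩) fun y z hyz hc => ?_)
    (fun y i hi => hi.1)
  obtain ⟨a, b, c, _⟩ := h.coverLabel_spec hyz
  exact h.not_le _ a ((hc ⟨a, b⟩).2.trans c)

/-- If `i` labels a cover `w ⋖ p`, then `p = w ⊔ j i`, and irreducibility forces `p = j i`. -/
theorem exists_eq_join [Finite α] (h : LabelData n x S j m) {p : α} (hp : SupIrred p) :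
    ∃ i ∈ S, j i = p := by
  obtain ⟨w, -, hw⟩ := exists_le_covBy_of_lt (bot_lt_iff_ne_bot.2 hp.ne_bot)
  obtain ⟨a, b, c, _⟩ := h.coverLabel_spec hw
  refine ⟨_, a, ((hp.2 (hw.eq_or_eq le_sup_left (sup_le hw.le b) |>.resolve_left
    fun e => h.not_le _ a ((sup_eq_left.1 e).trans c))).resolve_left hw.ne)⟩

theorem eq_of_join_le [Finite α] (h : LabelData n x S j m) {i k : ℕ} (hi : i ∈ S) (hk : k ∈ S)
    (h1 : j k ≤ x i) (h2 : ¬ j k ≤ x (i - 1)) : k = i := by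
  have := h.subset hi
  have := h.subset hk
  simp only [Set.mem_Icc] at *
  rcases lt_trichotomy k i with hlt | heq | hlt
  · exact absurd ((h.join_le k hk).trans (h.monotone (by omega) (by omega))) h2
  · exact heq
  · exact absurd (h1.trans ((h.monotone (by omega) (by omega)).trans (h.le_meet k hk)))
      (h.not_le k hk)

/-- Some join-irreducible separates `x i` from `m i`. It is a `j k` with `j k ≤ x i` and `j k ≰ x (i
- 1)`, which forces `k = i`. -/
theorem supIrred_join [Finite α] (h : LabelData n x S j m) {i : ℕ} (hi : i ∈ S) :
    SupIrred (j i) := by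
  obtain ⟨p, hp, h1, h2⟩ := exists_supIrred_le_not_le
    (fun hc => h.not_le i hi ((h.join_le i hi).trans hc))
  obtain ⟨k, hk, rfl⟩ := h.exists_eq_join hp
  rwa [h.eq_of_join_le hi hk h1 fun hc => h2 (hc.trans (h.le_meet i hi))] at hp

theorem injOn_join (h : LabelData n x S j m) : Set.InjOn j S := by
  intro i hi k hk hik
  rcases lt_trichotomy i k with hlt | heq | hlt
  · exact absurd (hik ▸ h.join_le_meet hi hk hlt) (h.not_le k hk)
  · exact heq
  · exact absurd (hik ▸ h.join_le_meet hk hi hlt) (h.not_le i hi)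

theorem setOf_supIrred [Finite α] (h : LabelData n x S j m) : {p : α | SupIrred p} = j '' S :=
  Set.ext fun p => ⟨fun hp => h.exists_eq_join hp, by rintro ⟨i, hi, rfl⟩; exact h.supIrred_join hi⟩

theorem setOf_infIrred [Finite α] (h : LabelData n x S j m) : {p : α | InfIrred p} = m '' S := by
  ext p
  constructor
  · intro hp
    obtain ⟨i, hi, hip⟩ := h.dual.exists_eq_join (p := OrderDual.toDual p) hp.dual
    exact ⟨_, hi.2, hip⟩
  · rintro ⟨i, hi, rfl⟩
    have hin := h.subset hi
    have he : n + 1 - (n + 1 - i) = i := by have := hin.2; omega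
    have := h.dual.supIrred_join (i := n + 1 - i)
      ⟨⟨by have := hin.2; omega, by have := hin.1; omega⟩, he.symm ▸ hi⟩
    rw [he] at this
    exact this.ofDual

theorem injOn_meet (h : LabelData n x S j m) : Set.InjOn m S := by
  intro i hi k hk hik
  rcases lt_trichotomy i k with hlt | heq | hlt
  · exact absurd (hik ▸ h.join_le_meet hi hk hlt) (h.not_le i hi)
  · exact heq
  · exact absurd (hik ▸ h.join_le_meet hk hi hlt) (h.not_le k hk)

theorem covBy_of_mem (h : LabelData n x S j m) {i : ℕ} (hi : i ∈ S) : x (i - 1) ⋖ x i := by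
  have hin := h.subset hi
  have := h.wcovBy (i - 1) (by have := hin.1; have := hin.2; omega)
  rw [Nat.sub_add_cancel hin.1] at this
  exact this.covBy_of_ne fun e =>
    h.not_le i hi ((h.join_le i hi).trans (e.symm.le.trans (h.le_meet i hi)))

theorem eq_of_notMem (h : LabelData n x S j m) {i : ℕ} (hi : i < n) (hS : i + 1 ∉ S) :
    x i = x (i + 1) := by
  by_contra hne
  exact hS (h.label (i + 1) ⟨by omega, by omega⟩ _ _ ((h.wcovBy i hi).covBy_of_ne hne)
    le_sup_right inf_le_left).1

/-- Removing repetitions from the weak chain. -/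
theorem exists_isLeftModularChain (h : LabelData n x S j m) :
    ∃ (x' : ℕ → α) (e : ℕ → ℕ), IsLeftModularChain S.ncard x' ∧
      StrictMonoOn e (Set.Icc 1 S.ncard) ∧
      ∀ y z : α, y ⋖ z → coverLabel x y z = e (coverLabel x' y z) := by
  classical
  -- `c i` counts the elements of `S` up to `i`.
  let c : ℕ → ℕ := fun i => Nat.count (· ∈ S) (i + 1)
  have h0S : 0 ∉ S := fun h0 => by have := (h.subset h0).1; omega
  have c0 : c 0 = 0 := by simp [c, Nat.count_succ, h0S]
  have cs : ∀ i, c (i + 1) = c i + if i + 1 ∈ S then 1 else 0 := fun i => Nat.count_succ _ _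
  have cmono : Monotone c := fun a b hab => Nat.count_monotone _ (by omega)
  have cpred : ∀ i ∈ S, c i = c (i - 1) + 1 := fun i hi => by
    have := cs (i - 1)
    rwa [Nat.sub_add_cancel (h.subset hi).1, if_pos hi] at this
  have cn : S.ncard = c n := by
    have : S = ↑((Finset.range (n + 1)).filter (· ∈ S)) := by
      ext i
      simp only [Finset.coe_filter, Finset.mem_range, Set.mem_ofPred_eq]
      exact ⟨fun hi => ⟨by have := (h.subset hi).2; omega, hi⟩, fun hi => hi.2⟩
    rw [this, Set.ncard_coe_finset, ← Nat.count_eq_card_filter_range]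
  rw [cn]
  -- `e k` is the `k`-th element of `S` for `1 ≤ k ≤ c n`, and `e 0 = 0` gives the bottom of the
  -- chain.
  let e : ℕ → ℕ := fun k => sInf {i | k ≤ c i}
  have e_le : ∀ {k i}, k ≤ c i → e k ≤ i := fun hk => Nat.sInf_le hk
  have le_c : ∀ k ≤ c n, k ≤ c (e k) := fun k hk => Nat.sInf_mem (s := {i | k ≤ c i}) ⟨n, hk⟩
  have key : ∀ k < c n, e (k + 1) ∈ S ∧ c (e (k + 1)) = k + 1 := by
    intro k hk
    have h1 := le_c (k + 1) hk
    obtain ⟨i, hi⟩ : ∃ i, e (k + 1) = i + 1 := Nat.exists_eq_succ_of_ne_zero fun h0 => by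
      rw [h0, c0] at h1
      omega
    have h2 : ¬ k + 1 ≤ c i := fun hc => by have := e_le hc; omega
    have h3 := cs i
    rw [hi] at h1 ⊢
    split_ifs at h3 with hS
    · exact ⟨hS, by omega⟩
    · omega
  have e0 : e 0 = 0 := Nat.le_zero.1 (e_le (Nat.zero_le _))
  have ce : ∀ k ≤ c n, c (e k) = k := by
    intro k hk
    cases k with
    | zero => rw [e0, c0]
    | succ k => exact (key k hk).2
  have xeq : ∀ {i k}, i ≤ k → k ≤ n → c i = c k → x i = x k := by
    intro i k hik
    induction k, hik using Nat.le_induction with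
    | base => exact fun _ _ => rfl
    | succ k hik ih =>
      intro hk hc
      have h1 := cs k
      have h2 := cmono hik
      split_ifs at h1 with hS
      · omega
      · rw [ih (by omega) (by omega), h.eq_of_notMem (by omega) hS]
  refine ⟨fun k => x (e k), e, ⟨?_, ?_, ?_, ?_⟩, ?_, ?_⟩
  · simp [e0, h.bot]
  · exact (xeq (e_le le_rfl) le_rfl (ce _ le_rfl)).trans h.top
  · intro k hk
    obtain ⟨h1, h2⟩ := key k hk
    have h3 := cpred _ h1
    have h4 : x (e k) = x (e (k + 1) - 1) :=
      xeq (e_le (by omega)) (by have := (h.subset h1).2; omega) (by rw [ce k hk.le]; omega)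
    change x (e k) ⋖ x (e (k + 1))
    rw [h4]
    exact h.covBy_of_mem h1
  · exact fun k hk => h.leftModular _ (e_le hk)
  · intro a ha b hb hab
    refine lt_of_le_of_ne (e_le (hab.le.trans (le_c b hb.2))) fun hc => hab.ne ?_
    rw [← ce a ha.2, ← ce b hb.2, hc]
  · intro y z hyz
    obtain ⟨hS, hj, hm, h1, h2⟩ := h.coverLabel_spec hyz
    set i := coverLabel x y z
    have hin := h.subset hS
    have hci := cpred i hS
    have hei : e (c i) = i := by
      refine le_antisymm (e_le le_rfl) ?_
      by_contra! hc
      have := cmono (show e (c i) ≤ i - 1 by omega)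
      rw [ce (c i) (cmono hin.2)] at this
      omega
    suffices coverLabel (fun k => x (e k)) y z = c i by rw [this, hei]
    refine le_antisymm (Nat.sInf_le (by change y ⊔ x (e (c i)) ⊓ z = z; rw [hei, h1])) ?_
    refine le_csInf ⟨c i, by change y ⊔ x (e (c i)) ⊓ z = z; rw [hei, h1]⟩ fun k hk => ?_
    by_contra! hlt
    have hk' : y ⊔ x (e k) ⊓ z = z := hk
    have h3 : x (e k) ⊓ z ≤ y := (inf_le_inf_right z
      (h.monotone (e_le (show k ≤ c (i - 1) by omega)) (by have := hin.2; omega))).trans h2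
    rw [sup_eq_left.2 h3] at hk'
    exact hyz.ne hk'

/-- The strict chain and `krullDim_le` pin the length to `S.ncard`, and `j`, `m` enumerate the
irreducibles by `S` without repetition. -/
theorem isTrim [Finite α] (h : LabelData n x S j m) : IsTrim α := by
  obtain ⟨x', e, hx', -⟩ := h.exists_isLeftModularChain
  refine ⟨⟨S.ncard, le_antisymm h.krullDim_le hx'.le_krullDim, ?_, ?_⟩, _, x', hx'⟩
  · rw [h.setOf_supIrred, h.injOn_join.ncard_image]
  · rw [h.setOf_infIrred, h.injOn_meet.ncard_image]

theorem isLeftModularLabelling (h : LabelData n x S j m) {γ : α → α → ℕ}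
    (hγ : ∀ y z, y ⋖ z → γ y z = coverLabel x y z) : IsLeftModularLabelling γ := by
  obtain ⟨x', e, hx', he, hl⟩ := h.exists_isLeftModularChain
  exact ⟨_, x', e, hx', he, fun y z hyz => (hγ y z hyz).trans (hl y z hyz)⟩

end LabelData

/-! ### Trim lattices carry label data -/

theorem downLabels_congr {α : Type*} [Lattice α] {γ γ' : α → α → ℕ}
    (h : ∀ y z, y ⋖ z → γ y z = γ' y z) : downLabels γ = downLabels γ' := by
  ext y i
  exact exists_congr fun w => and_congr_right fun hw => by rw [h w y hw]

theorem upLabels_congr {α : Type*} [Lattice α] {γ γ' : α → α → ℕ}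
    (h : ∀ y z, y ⋖ z → γ y z = γ' y z) : upLabels γ = upLabels γ' := by
  ext y i
  exact exists_congr fun w => and_congr_right fun hw => by rw [h y w hw]

theorem LabelData.of_isTrim {L : Type*} [Lattice L] [BoundedOrder L] [Finite L] (hL : IsTrim L)
    {n : ℕ} {x : ℕ → L} (hx : IsLeftModularChain n x) :
    ∃ j m : ℕ → L, LabelData n x (Set.Icc 1 n) j m := by
  have hmono : ∀ {i k}, i ≤ k → k ≤ n → x i ≤ x k := by
    intro i k hik
    induction k, hik using Nat.le_induction with
    | base => exact fun _ => le_rfl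
    | succ k _ ih => exact fun hk => (ih (by omega)).trans (hx.covBy k (by omega)).le
  have hcov : ∀ i ∈ Set.Icc 1 n, x (i - 1) ⋖ x i := by
    rintro i ⟨h1, h2⟩
    have := hx.covBy (i - 1) (by omega)
    rwa [Nat.sub_add_cancel h1] at this
  obtain ⟨⟨N, hN, hJ, hM⟩, -⟩ := hL
  -- A left modular chain has maximal length. Across `y ⋖ z`, the least `i` with `z ≤ x i ⊔ y` is
  -- new in the set: `x (i - 1) ⊔ z` must equal `x i ⊔ y`, the upper end of a weak cover.
  have hdim : Order.krullDim L ≤ (Set.Icc 1 n).ncard := by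
    refine krullDim_le_ncard_of_strictMono (Set.finite_Icc 1 n)
      (fun y => {i | i ∈ Set.Icc 1 n ∧ x i ≤ x (i - 1) ⊔ y})
      (strictMono_of_covBy (fun y z hyz i hi => ⟨hi.1, hi.2.trans (sup_le_sup_left hyz _)⟩)
        fun y z hyz hc => ?_) (fun y i hi => hi.1)
    have hz : ∃ i, z ≤ x i ⊔ y := ⟨n, by simp [hx.top]⟩
    classical
    have hspec := Nat.find_spec hz
    have hle : Nat.find hz ≤ n := Nat.find_min' hz (by simp [hx.top])
    have hpos : 1 ≤ Nat.find hz := by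
      by_contra! h0
      rw [show Nat.find hz = 0 by omega, hx.bot] at hspec
      exact hyz.lt.not_ge (by simpa using hspec)
    have hmin := Nat.find_min hz (m := Nat.find hz - 1) (by omega)
    set i := Nat.find hz
    have hi : i ∈ Set.Icc 1 n := ⟨hpos, hle⟩
    have hw := (hx.leftModular i hle).sup_wcovBy (hcov i hi).wcovBy y
    rcases hw.eq_or_eq (c := x (i - 1) ⊔ z) (sup_le_sup_left hyz.le _)
      (sup_le (le_sup_left.trans hw.le) hspec) with e | e
    · exact hmin (le_sup_right.trans e.le)
    · exact hmin (hspec.trans (sup_le (hc ⟨hi, le_sup_left.trans e.symm.le⟩).2 le_sup_right))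
  have hNn : N ≤ n := by
    rw [hN] at hdim
    simpa using hdim
  have exJ : ∀ i, ∃ p, i ∈ Set.Icc 1 n → SupIrred p ∧ p ≤ x i ∧ ¬ p ≤ x (i - 1) := fun i => by
    by_cases hi : i ∈ Set.Icc 1 n
    · obtain ⟨p, hp⟩ := exists_supIrred_le_not_le (hcov i hi).lt.not_ge
      exact ⟨p, fun _ => hp⟩
    · exact ⟨⊥, fun h => absurd h hi⟩
  have exM : ∀ i, ∃ p, i ∈ Set.Icc 1 n → InfIrred p ∧ x (i - 1) ≤ p ∧ ¬ x i ≤ p := fun i => by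
    by_cases hi : i ∈ Set.Icc 1 n
    · obtain ⟨p, hp⟩ := exists_infIrred_le_not_le (hcov i hi).lt.not_ge
      exact ⟨p, fun _ => hp⟩
    · exact ⟨⊥, fun h => absurd h hi⟩
  choose j hj using exJ
  choose m hm using exM
  have hjlt : ∀ {i k}, i ∈ Set.Icc 1 n → k ∈ Set.Icc 1 n → i < k → j i ≤ x (k - 1) :=
    fun hi hk hik => (hj _ hi).2.1.trans (hmono (by omega) (by have := hk.2; omega))
  have hmlt : ∀ {i k}, i ∈ Set.Icc 1 n → k ∈ Set.Icc 1 n → i < k → x i ≤ m k :=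
    fun hi hk hik => (hmono (by omega) (by have := hk.2; omega)).trans (hm _ hk).2.1
  have hjinj : Set.InjOn j (Set.Icc 1 n) := by
    intro i hi k hk e
    rcases lt_trichotomy i k with h | h | h
    · exact absurd (e ▸ hjlt hi hk h) (hj k hk).2.2
    · exact h
    · exact absurd (e ▸ hjlt hk hi h) (hj i hi).2.2
  have hminj : Set.InjOn m (Set.Icc 1 n) := by
    intro i hi k hk e
    rcases lt_trichotomy i k with h | h | h
    · exact absurd (e ▸ hmlt hi hk h) (hm i hi).2.2
    · exact h
    · exact absurd (e ▸ hmlt hk hi h) (hm k hk).2.2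
  -- The `n` chosen irreducibles are distinct and there are only `N ≤ n` in all, so they exhaust the
  -- irreducibles. Here extremality enters.
  have hJeq : j '' Set.Icc 1 n = {p | SupIrred p} :=
    Set.eq_of_subset_of_ncard_le (by rintro _ ⟨i, hi, rfl⟩; exact (hj i hi).1)
      (by rw [hjinj.ncard_image, hJ]; simpa using hNn)
  have hMeq : m '' Set.Icc 1 n = {p | InfIrred p} :=
    Set.eq_of_subset_of_ncard_le (by rintro _ ⟨i, hi, rfl⟩; exact (hm i hi).1)
      (by rw [hminj.ncard_image, hM]; simpa using hNn)
  refine ⟨j, m, hx.bot, hx.top, fun i hi => (hx.covBy i hi).wcovBy, hx.leftModular, le_rfl,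
    fun i hi => (hj i hi).2.1, fun i hi => (hm i hi).2.1, fun i hi hc => ?_, ?_⟩
  · have hle : x (i - 1) ⊔ j i ≤ x i := sup_le (hcov i hi).le (hj i hi).2.1
    rcases (hcov i hi).eq_or_eq le_sup_left hle with e | e
    · exact (hj i hi).2.2 (sup_eq_left.1 e)
    · exact (hm i hi).2.2 (e.symm.le.trans (sup_le (hm i hi).2.1 hc))
  · intro i hi y z hyz h1 h2
    refine ⟨hi, ?_, ?_⟩
    -- A join-irreducible below `x i ⊓ z` but not below `y` is some `j k`. For `k < i` it would lie
    -- in `x (i - 1) ⊓ z ≤ y`, and for `k > i` it would lie below `x (k - 1)`; hence `k = i`.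
    · have hz : ¬ x i ⊓ z ≤ y := fun hc => by
        have := hx.leftModular i hi.2 y z hyz.le
        rw [inf_eq_right.2 h1, sup_eq_left.2 hc] at this
        exact hyz.ne this.symm
      obtain ⟨p, hp, hpz, hpy⟩ := exists_supIrred_le_not_le hz
      obtain ⟨k, hk, rfl⟩ : p ∈ j '' Set.Icc 1 n := hJeq ▸ hp
      rcases lt_trichotomy k i with h | rfl | h
      · exact absurd ((le_inf (hjlt hk hi h) (hpz.trans inf_le_right)).trans h2) hpy
      · exact hpz.trans inf_le_right
      · exact absurd ((hpz.trans inf_le_left).trans (hmono (by omega) (by have := hk.2; omega)))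
          (hj k hk).2.2
    · have hz : ¬ z ≤ y ⊔ x (i - 1) := fun hc => by
        have := hx.leftModular (i - 1) (by have := hi.2; omega) y z hyz.le
        rw [inf_eq_right.2 hc, sup_eq_left.2 h2] at this
        exact hyz.ne this.symm
      obtain ⟨p, hp, hpy, hpz⟩ := exists_infIrred_le_not_le hz
      obtain ⟨k, hk, rfl⟩ : p ∈ m '' Set.Icc 1 n := hMeq ▸ hp
      rcases lt_trichotomy k i with h | rfl | h
      · exact absurd ((hmono (by omega) (by have := hi.2; omega)).trans (le_sup_right.trans hpy))
          (hm k hk).2.2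
      · exact le_sup_left.trans hpy
      · exact absurd (h1.trans (sup_le (le_sup_left.trans hpy) (hmlt hi hk h))) hpz

/-! ### Faces of intervals, deletion and link -/

theorem isIndependent_Iic_iff {α : Type*} [Lattice α] {S : Set ℕ} {j m : ℕ → α} {u : α} {A : Set ℕ} :
    IsIndependent {i | i ∈ S ∧ j i ≤ u} (fun i => (⟨j i ⊓ u, inf_le_right⟩ : Set.Iic u))
      (fun i => ⟨m i ⊓ u, inf_le_right⟩) A ↔ IsIndependent S j m A ∧ ∀ i ∈ A, j i ≤ u := by
  constructor
  · intro hA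
    refine ⟨⟨fun i hi => (hA.1 hi).1, fun i hi k hk hik => ?_⟩, fun i hi => (hA.1 hi).2⟩
    have : j i ⊓ u ≤ m k ⊓ u := hA.2 i hi k hk hik
    rw [inf_eq_left.2 (hA.1 hi).2] at this
    exact this.trans inf_le_left
  · rintro ⟨h1, h2⟩
    exact ⟨fun i hi => ⟨h1.1 hi, h2 i hi⟩, fun i hi k hk hik =>
      inf_le_inf_right u (h1.2 i hi k hk hik)⟩

theorem isIndependent_Ici_iff {α : Type*} [Lattice α] {S : Set ℕ} {j m : ℕ → α} {v : α} {A : Set ℕ} :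
    IsIndependent {i | i ∈ S ∧ v ≤ m i} (fun i => (⟨j i ⊔ v, le_sup_right⟩ : Set.Ici v))
      (fun i => ⟨m i ⊔ v, le_sup_right⟩) A ↔ IsIndependent S j m A ∧ ∀ i ∈ A, v ≤ m i := by
  constructor
  · intro hA
    refine ⟨⟨fun i hi => (hA.1 hi).1, fun i hi k hk hik => ?_⟩, fun i hi => (hA.1 hi).2⟩
    have : j i ⊔ v ≤ m k ⊔ v := hA.2 i hi k hk hik
    rw [sup_eq_left.2 (hA.1 hk).2] at this
    exact le_sup_left.trans this
  · rintro ⟨h1, h2⟩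
    exact ⟨fun i hi => ⟨h1.1 hi, h2 i hi⟩, fun i hi k hk hik =>
      sup_le_sup_right (h1.2 i hi k hk hik) v⟩

namespace LabelData

variable {α : Type*} [Lattice α] [BoundedOrder α] {n : ℕ} {x : ℕ → α} {S : Set ℕ} {j m : ℕ → α}

theorem isSimplicialComplex [Finite α] (h : LabelData n x S j m) :
    IsSimplicialComplex S (independenceComplex (coverLabel x)) where
  subset_vertices F hF := (h.mem_independenceComplex.1 hF).1
  empty_mem := h.mem_independenceComplex.2 ⟨Set.empty_subset _, by simp⟩
  singleton_mem v hv := h.mem_independenceComplex.2 ⟨by simpa using hv, by simp⟩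
  down_closed F hF G hG := by
    rw [h.mem_independenceComplex] at hF ⊢
    exact ⟨hG.trans hF.1, fun i hi k hk => hF.2 i (hG hi) k (hG hk)⟩

theorem isFlag [Finite α] (h : LabelData n x S j m) :
    IsFlag (independenceComplex (coverLabel x)) := by
  intro A _ hA
  simp only [h.mem_independenceComplex] at hA ⊢
  exact ⟨fun i hi => (hA i hi i hi).1 (by simp),
    fun i hi k hk => (hA i hi k hk).2 i (by simp) k (by simp)⟩

theorem joinLabel_join (h : LabelData n x S j m) {i : ℕ} (hi : i ∈ S) :
    joinLabel x (j i) = i := by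
  refine le_antisymm (Nat.sInf_le (h.join_le i hi)) (le_csInf ⟨i, h.join_le i hi⟩ fun k hk => ?_)
  by_contra! hlt
  have := (h.subset hi).2
  exact h.not_le i hi ((le_trans hk (h.monotone (by omega) (by omega))).trans (h.le_meet i hi))

theorem meetLabel_meet (h : LabelData n x S j m) {i : ℕ} (hi : i ∈ S) :
    meetLabel n x (m i) = i := by
  have hin := h.subset hi
  refine IsGreatest.csSup_eq ⟨⟨hin.1, hin.2, h.le_meet i hi⟩, fun k hk => ?_⟩
  by_contra! hlt
  exact h.not_le i hi ((h.join_le i hi).trans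
    ((h.monotone (by omega) (by have := hk.2.1; omega)).trans hk.2.2))

/-- The tests by `j` and `m` give the same answer in the interval, so with the repeating chain the
labels agree without renaming. -/
theorem restrictLabelling_Iic (h : LabelData n x S j m) (u : α) (y z : Set.Iic u) (hyz : y ⋖ z) :
    restrictLabelling (coverLabel x) (Set.Iic u) y z
      = coverLabel (fun i => (⟨x i ⊓ u, inf_le_right⟩ : Set.Iic u)) y z := by
  have hyz' : (y : α) ⋖ z :=
    ⟨hyz.1, fun c hc1 hc2 => hyz.2 (c := ⟨c, hc2.le.trans z.2⟩) hc1 hc2⟩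
  obtain ⟨a, b, c, _⟩ := h.coverLabel_spec hyz'
  symm
  exact ((h.Iic u).coverLabel_eq_iff hyz).2 ⟨⟨a, b.trans z.2⟩,
    show j _ ⊓ u ≤ z from inf_le_left.trans b, show (y : α) ≤ m _ ⊓ u from le_inf c y.2⟩

theorem restrictLabelling_Ici (h : LabelData n x S j m) (v : α) (y z : Set.Ici v) (hyz : y ⋖ z) :
    restrictLabelling (coverLabel x) (Set.Ici v) y z
      = coverLabel (fun i => (⟨x i ⊔ v, le_sup_right⟩ : Set.Ici v)) y z := by
  have hyz' : (y : α) ⋖ z :=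
    ⟨hyz.1, fun c hc1 hc2 => hyz.2 (c := ⟨c, le_trans y.2 hc1.le⟩) hc1 hc2⟩
  obtain ⟨a, b, c, _⟩ := h.coverLabel_spec hyz'
  symm
  exact ((h.Ici v).coverLabel_eq_iff hyz).2 ⟨⟨a, le_trans y.2 c⟩,
    show j _ ⊔ v ≤ z from sup_le b z.2, show (y : α) ≤ m _ ⊔ v from c.trans le_sup_left⟩

theorem mem_restrictLabelling_Iic [Finite α] (h : LabelData n x S j m) (u : α) {A : Set ℕ} :
    (A ∈ independenceComplex (restrictLabelling (coverLabel x) (Set.Iic u)) ↔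
      IsIndependent S j m A ∧ ∀ i ∈ A, j i ≤ u) ∧
    (A ∈ upLabelSets (restrictLabelling (coverLabel x) (Set.Iic u)) ↔
      IsIndependent S j m A ∧ ∀ i ∈ A, j i ≤ u) := by
  rw [independenceComplex, upLabelSets, downLabels_congr (h.restrictLabelling_Iic u),
    upLabels_congr (h.restrictLabelling_Iic u), ← isIndependent_Iic_iff]
  exact ⟨(h.Iic u).mem_independenceComplex, (h.Iic u).mem_upLabelSets⟩

theorem mem_restrictLabelling_Ici [Finite α] (h : LabelData n x S j m) (v : α) {A : Set ℕ} :
    (A ∈ independenceComplex (restrictLabelling (coverLabel x) (Set.Ici v)) ↔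
      IsIndependent S j m A ∧ ∀ i ∈ A, v ≤ m i) ∧
    (A ∈ upLabelSets (restrictLabelling (coverLabel x) (Set.Ici v)) ↔
      IsIndependent S j m A ∧ ∀ i ∈ A, v ≤ m i) := by
  rw [independenceComplex, upLabelSets, downLabels_congr (h.restrictLabelling_Ici v),
    upLabels_congr (h.restrictLabelling_Ici v), ← isIndependent_Ici_iff]
  exact ⟨(h.Ici v).mem_independenceComplex, (h.Ici v).mem_upLabelSets⟩

/-- For the smallest label `l`, the condition `j l ≤ m i` is automatic when `i ≠ l` and fails when
`i = l`. -/
theorem mem_deletion_iff [Finite α] (h : LabelData n x S j m) {l : ℕ} (hl : l ∈ S)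
    (hmin : ∀ i ∈ S, l ≤ i) {A : Set ℕ} :
    A ∈ deletion (independenceComplex (coverLabel x)) {l} ↔
      IsIndependent S j m A ∧ ∀ i ∈ A, j l ≤ m i := by
  rw [deletion, Set.mem_ofPred_eq, h.mem_independenceComplex, Set.inter_singleton_eq_empty]
  refine and_congr_right fun hA => ⟨fun h1 i hi => ?_, fun h1 h2 => h.not_le l hl (h1 l h2)⟩
  exact h.join_le_meet hl (hA.1 hi)
    (lt_of_le_of_ne (hmin i (hA.1 hi)) fun e => h1 (e ▸ hi))

/-- Compatibility with the smallest label `l` reduces to `j i ≤ m l`, which also excludes `i = l`.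
-/
theorem mem_link_iff [Finite α] (h : LabelData n x S j m) {l : ℕ} (hl : l ∈ S)
    (hmin : ∀ i ∈ S, l ≤ i) {A : Set ℕ} :
    A ∈ link (independenceComplex (coverLabel x)) {l} ↔
      IsIndependent S j m A ∧ ∀ i ∈ A, j i ≤ m l := by
  rw [link, Set.mem_ofPred_eq, h.mem_independenceComplex, h.mem_independenceComplex,
    Set.inter_singleton_eq_empty]
  refine and_congr_right fun hA => ⟨fun ⟨h1, h2⟩ i hi => ?_, fun h1 => ?_⟩
  · exact h2.2 i (Or.inl hi) l (Or.inr rfl) fun e => h1 (e ▸ hi)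
  · refine ⟨fun h2 => h.not_le l hl (h1 l h2),
      Set.union_subset hA.1 (Set.singleton_subset_iff.2 hl), ?_⟩
    rintro i (hi | rfl) k (hk | rfl) hik
    · exact hA.2 i hi k hk hik
    · exact h1 i hi
    · exact h.join_le_meet hl (hA.1 hk) (lt_of_le_of_ne (hmin k (hA.1 hk)) hik)
    · exact absurd rfl hik

end LabelData

end TrimLattice

theorem proposition5p1 {L : Type*} [Lattice L] [BoundedOrder L] [Finite L]
    (hL : TrimLattice.IsTrim L) (n : ℕ) (x : ℕ → L) (hx : TrimLattice.IsLeftModularChain n x) :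
    -- downward label sets and upward label sets coincide
    TrimLattice.independenceComplex (TrimLattice.coverLabel x)
        = TrimLattice.upLabelSets (TrimLattice.coverLabel x) ∧
    -- they form a simplicial complex with vertex set `{1, …, n}`
    TrimLattice.IsSimplicialComplex (Set.Icc 1 n)
        (TrimLattice.independenceComplex (TrimLattice.coverLabel x)) ∧
    -- which is flag
    TrimLattice.IsFlag (TrimLattice.independenceComplex (TrimLattice.coverLabel x)) ∧
    -- if `n ≥ 1`, there are a unique join-irreducible `j` and meet-irreducible `m` of label `1`
    (1 ≤ n → ∃ j m : L,
      {j' : L | SupIrred j' ∧ TrimLattice.joinLabel x j' = 1} = {j} ∧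
      {m' : L | InfIrred m' ∧ TrimLattice.meetLabel n x m' = 1} = {m} ∧
      -- the interval `[j, ⊤]` is a trim lattice with left modular labelling the restriction of
      -- that of `L`, and its independence complex is the deletion
      (TrimLattice.IsTrim (Set.Ici j) ∧
        TrimLattice.IsLeftModularLabelling
          (TrimLattice.restrictLabelling (TrimLattice.coverLabel x) (Set.Ici j)) ∧
        TrimLattice.independenceComplex
            (TrimLattice.restrictLabelling (TrimLattice.coverLabel x) (Set.Ici j))
          = TrimLattice.deletion
              (TrimLattice.independenceComplex (TrimLattice.coverLabel x)) {1} ∧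
        TrimLattice.upLabelSets
            (TrimLattice.restrictLabelling (TrimLattice.coverLabel x) (Set.Ici j))
          = TrimLattice.deletion
              (TrimLattice.independenceComplex (TrimLattice.coverLabel x)) {1}) ∧
      -- the interval `[⊥, m]` is a trim lattice with left modular labelling the restriction of
      -- that of `L`, and its independence complex is the link
      (TrimLattice.IsTrim (Set.Iic m) ∧
        TrimLattice.IsLeftModularLabelling
          (TrimLattice.restrictLabelling (TrimLattice.coverLabel x) (Set.Iic m)) ∧
        TrimLattice.independenceComplex
            (TrimLattice.restrictLabelling (TrimLattice.coverLabel x) (Set.Iic m))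
          = TrimLattice.link
              (TrimLattice.independenceComplex (TrimLattice.coverLabel x)) {1} ∧
        TrimLattice.upLabelSets
            (TrimLattice.restrictLabelling (TrimLattice.coverLabel x) (Set.Iic m))
          = TrimLattice.link
              (TrimLattice.independenceComplex (TrimLattice.coverLabel x)) {1})) := by
  obtain ⟨j, m, h⟩ := TrimLattice.LabelData.of_isTrim hL hx
  refine ⟨Set.ext fun A => h.mem_independenceComplex.trans h.mem_upLabelSets.symm,
    h.isSimplicialComplex, h.isFlag, fun hn => ?_⟩
  have h1 : 1 ∈ Set.Icc 1 n := ⟨le_rfl, hn⟩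
  have hmin : ∀ i ∈ Set.Icc 1 n, 1 ≤ i := fun i hi => hi.1
  refine ⟨j 1, m 1, ?_, ?_, ?_, ?_⟩
  · ext p
    constructor
    · rintro ⟨hp, hl⟩
      obtain ⟨i, hi, rfl⟩ := h.exists_eq_join hp
      rw [h.joinLabel_join hi] at hl
      rw [hl]
      rfl
    · rintro rfl
      exact ⟨h.supIrred_join h1, h.joinLabel_join h1⟩
  · ext p
    constructor
    · rintro ⟨hp, hl⟩
      obtain ⟨i, hi, rfl⟩ : p ∈ m '' Set.Icc 1 n := h.setOf_infIrred ▸ hp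
      rw [h.meetLabel_meet hi] at hl
      rw [hl]
      rfl
    · rintro rfl
      exact ⟨h.setOf_infIrred.ge ⟨1, h1, rfl⟩, h.meetLabel_meet h1⟩
  · exact ⟨(h.Ici _).isTrim, (h.Ici _).isLeftModularLabelling (h.restrictLabelling_Ici _),
      Set.ext fun A => (h.mem_restrictLabelling_Ici _).1.trans (h.mem_deletion_iff h1 hmin).symm,
      Set.ext fun A => (h.mem_restrictLabelling_Ici _).2.trans (h.mem_deletion_iff h1 hmin).symm⟩
  · exact ⟨(h.Iic _).isTrim, (h.Iic _).isLeftModularLabelling (h.restrictLabelling_Iic _),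
      Set.ext fun A => (h.mem_restrictLabelling_Iic _).1.trans (h.mem_link_iff h1 hmin).symm,
      Set.ext fun A => (h.mem_restrictLabelling_Iic _).2.trans (h.mem_link_iff h1 hmin).symm⟩
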